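/- Theorem (Local Recovery implies an Area Law). Consider a system of $n$ qubits with Hamiltonian $H=\sum_{\gamma\in\Gamma} H_\gamma$, a finite sum of Hermitian terms, let $\beta\ge 0$ be the inverse temperature and let $\rho = e^{-\beta H}/\mathrm{Tr}[e^{-\beta H}]$ be the Gibbs state. Let $A\subseteq[n]$ be a region with complement $\bar A$, and let $\partial H$ be the sum of those terms $H_\gamma$ whose support (the set of qubits on which $H_\gamma$ acts nontrivially) meets both $A$ and $\bar A$. Let $\sigma$ be an $n$-qubit state with marginals $\sigma_A$, $\sigma_{\bar A}$, and suppose that there is a quantum channel (completely positive trace-preserving map) $\mathcal R$ on $n$ qubits with $$\big\|\mathcal R[\sigma_{\bar A}\otimes\sigma_A]-\sigma\big\|_1\le \epsilon_{\mathrm{Markov}}\qquad\text{and}\qquad \mathcal R[\rho]=\rho .$$ Then $$ I(A:\bar A)_\sigma \;\le\; 2\beta\,\|\partial H\| + 4\,\epsilon_{\mathrm{Markov}}\cdot\max\Big(\log\frac1{\epsilon_{\mathrm{Markov}}},\ \beta\|H\|,\ n\Big).$$ Here $I(A:\bar A)_\sigma=S(\sigma_A)+S(\sigma_{\bar A})-S(\sigma)$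 with $S(\sigma)=-\mathrm{Tr}[\sigma\log\sigma]$ and $\log$ the natural logarithm, $\|\cdot\|$ is the operator norm, $\|\cdot\|_1$ is the trace norm, and for $\epsilon_{\mathrm{Markov}}=0$ the last term is read as $0$. -/

import Mathlib

open scoped Matrix ComplexOrder MatrixOrder Matrix.Norms.L2Operator Kronecker CStarAlgebra

/-- Complex matrices indexed by the computational basis `Λ → {0, 1}` of the Hilbert space
`(ℂ²)^{⊗ Λ}` of qubits placed at the sites of `Λ`. The norm `‖·‖` on this type is the operator
norm for the Euclidean norm (scope `Matrix.Norms.L2Operator`), and `≤` is the positive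
semidefinite (Loewner) order (scope `MatrixOrder`). -/
abbrev QubitOp (Λ : Type*) : Type _ := Matrix (Λ → Fin 2) (Λ → Fin 2) ℂ

noncomputable section

/-- Density matrices: positive semidefinite of unit trace. -/
def IsQuantumState {Λ : Type*} [Fintype Λ] [DecidableEq Λ] (σ : QubitOp Λ) : Prop :=
  σ.PosSemidef ∧ σ.trace = 1

/-- A completely positive map `R` that satisfies this is a quantum channel (CPTP map). -/
def IsTracePreserving {Λ : Type*} [Fintype Λ] [DecidableEq Λ]
    (R : QubitOp Λ →CP QubitOp Λ) : Prop :=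
  ∀ X : QubitOp Λ, (R X).trace = X.trace

/-- The trace norm (Schatten 1-norm) `‖X‖₁ = Tr |X|`, where `|X| = √(X† X)`. -/
def traceNorm {Λ : Type*} [Fintype Λ] [DecidableEq Λ] (X : QubitOp Λ) : ℝ :=
  (CFC.abs X).trace.re

/-- The von Neumann entropy `S(σ) = -Tr[σ log σ]`, with the natural logarithm. The matrix
logarithm is taken through the functional calculus, with the value `0` on the kernel, so that
`0 log 0 = 0`. -/
def vonNeumannEntropy {Λ : Type*} [Fintype Λ] [DecidableEq Λ] (σ : QubitOp Λ) : ℝ :=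
  -(σ * CFC.log σ).trace.re

/-- The Gibbs state `e^{-βH} / Tr[e^{-βH}]`. -/
def gibbsState {Λ : Type*} [Fintype Λ] [DecidableEq Λ] (β : ℝ) (H : QubitOp Λ) : QubitOp Λ :=
  (NormedSpace.exp (-(β : ℂ) • H)).trace⁻¹ • NormedSpace.exp (-(β : ℂ) • H)

section Regions

variable {Λ : Type*} [Fintype Λ] [DecidableEq Λ]

/-- The basis configuration on all sites that is `x` on `A` and `z` on the complement of `A`. -/
def glue (A : Finset Λ) (x : A → Fin 2) (z : ↥(Aᶜ) → Fin 2) : Λ → Fin 2 :=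
  fun i => if h : i ∈ A then x ⟨i, h⟩ else z ⟨i, Finset.mem_compl.mpr h⟩

/-- The marginal (reduced state) `σ_A` of `σ` on the region `A`: the partial trace over the
complement of `A`. -/
def marginal (A : Finset Λ) (σ : QubitOp Λ) : QubitOp A :=
  Matrix.of fun x y => ∑ z : ↥(Aᶜ) → Fin 2, σ (glue A x z) (glue A y z)

/-- The operator `X ⊗ Y` on all sites, for `X` on `A` and `Y` on the complement of `A`. -/
def regionTensor (A : Finset Λ) (X : QubitOp A) (Y : QubitOp ↥(Aᶜ)) : QubitOp Λ :=
  (X ⊗ₖ Y).submatrix (fun x => (fun i => x i, fun i => x i)) (fun x => (fun i => x i, fun i => x i))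

/-- The mutual information `I(A : Aᶜ)_σ = S(σ_A) + S(σ_{Aᶜ}) - S(σ)`. -/
def mutualInformation (A : Finset Λ) (σ : QubitOp Λ) : ℝ :=
  vonNeumannEntropy (marginal A σ) + vonNeumannEntropy (marginal Aᶜ σ) - vonNeumannEntropy σ

/-- `O` acts as the identity on the qubit at site `i`, i.e. `O = 1_i ⊗ O'` with `O'` an operator
on the remaining sites. -/
def ActsTriviallyAt (O : QubitOp Λ) (i : Λ) : Prop :=
  ∃ O' : QubitOp ↥(({i} : Finset Λ)ᶜ), O = regionTensor {i} 1 O'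

/-- The support of an operator: the sites on which it acts nontrivially. -/
def opSupport (O : QubitOp Λ) : Set Λ := {i | ¬ ActsTriviallyAt O i}

/-- The support of `O` meets both `A` and its complement. -/
def CrossesCut (A : Finset Λ) (O : QubitOp Λ) : Prop :=
  (∃ i ∈ A, i ∈ opSupport O) ∧ ∃ j ∈ Aᶜ, j ∈ opSupport O

open Classical in
/-- The boundary Hamiltonian `∂H`: the sum of the terms of `H = ∑ γ, h γ` that are
simultaneously supported on `A` and on its complement. -/
def boundaryHamiltonian {Γ : Type*} [Fintype Γ] (A : Finset Λ) (h : Γ → QubitOp Λ) : QubitOp Λ :=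
  ∑ γ with CrossesCut A (h γ), h γ

end Regions

end

/-!
Let `τ = σ_A ⊗ σ_Aᶜ`, so that `I(A : Aᶜ)_σ = S(τ) - S(σ)`. Up to the factor `β` and an additive
constant, the free energy of a state is its relative entropy to the Gibbs state. The channel fixes
the Gibbs state, so by the data processing inequality `S(τ) - S(R τ) ≤ β (Tr[τ H] - Tr[R(τ) H])`.
As `τ` and `σ` have the same marginals, their energies differ by the boundary terms only, which
gives `2 β ‖∂H‖`; replacing `R τ` by `σ` in the energy and in the entropy is paid for with Hölder's
inequality and a Fannes type bound.

Data processing is proved by writing the relative entropy as an integral over `t` of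
`sup_X 2 Re Tr[τ X] - Tr[ρ X Xᴴ] - t Tr[τ Xᴴ X]`: by the Schwarz inequality for the Heisenberg dual
`R†`, each `X` for the output states is dominated by `R† X` for the input states.
-/

section SpectralSums

variable {n : Type*} [Fintype n] [DecidableEq n] {X Y : Matrix n n ℂ}

lemma cfc_eq_mul_diagonal_mul_star (hX : X.IsHermitian) (f : ℝ → ℝ) :
    cfc f X = (hX.eigenvectorUnitary : Matrix n n ℂ) *
      Matrix.diagonal (fun i => (f (hX.eigenvalues i) : ℂ)) *
        star (hX.eigenvectorUnitary : Matrix n n ℂ) :=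
  hX.cfc_eq f

lemma eq_mul_diagonal_mul_star (hX : X.IsHermitian) :
    X = (hX.eigenvectorUnitary : Matrix n n ℂ) *
      Matrix.diagonal (fun i => (hX.eigenvalues i : ℂ)) *
        star (hX.eigenvectorUnitary : Matrix n n ℂ) :=
  (cfc_id ℝ X hX).symm.trans (cfc_eq_mul_diagonal_mul_star hX id)

lemma trace_mul_eq_sum_eigenvalues (hX : X.IsHermitian) (K : Matrix n n ℂ) :
    (X * K).trace = ∑ i, (hX.eigenvalues i : ℂ) *
      (star (hX.eigenvectorUnitary : Matrix n n ℂ) * K * hX.eigenvectorUnitary) i i := by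
  conv_lhs => rw [eq_mul_diagonal_mul_star hX, Matrix.mul_assoc, Matrix.mul_assoc,
    Matrix.trace_mul_comm, Matrix.mul_assoc]
  simp only [Matrix.trace, Matrix.diag_apply, Matrix.diagonal_mul]

lemma trace_cfc (hX : X.IsHermitian) (f : ℝ → ℝ) :
    (cfc f X).trace = ((∑ i, f (hX.eigenvalues i) : ℝ) : ℂ) := by
  rw [cfc_eq_mul_diagonal_mul_star hX, Matrix.trace_mul_cycle, Unitary.coe_star_mul_self,
    Matrix.one_mul, Matrix.trace_diagonal, Complex.ofReal_sum]

lemma cfc_mul_cfc (X : Matrix n n ℂ) (f g : ℝ → ℝ) :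
    cfc f X * cfc g X = cfc (fun x => f x * g x) X :=
  (cfc_mul f g X (X.finite_real_spectrum.continuousOn f)
    (X.finite_real_spectrum.continuousOn g)).symm

lemma posDef_cfc (hX : X.IsHermitian) {f : ℝ → ℝ} (hf : ∀ i, 0 < f (hX.eigenvalues i)) :
    (cfc f X).PosDef := by
  refine Matrix.isStrictlyPositive_iff_posDef.mp ((cfc_isStrictlyPositive_iff f X
    (X.finite_real_spectrum.continuousOn f) hX.isSelfAdjoint).mpr ?_)
  rw [hX.spectrum_real_eq_range_eigenvalues]
  exact Set.forall_mem_range.mpr hf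

lemma log_cfc (hX : X.IsHermitian) (f : ℝ → ℝ) :
    CFC.log (cfc f X) = cfc (fun x => Real.log (f x)) X :=
  (cfc_comp' Real.log f X ((X.finite_real_spectrum.image f).continuousOn _)
    (X.finite_real_spectrum.continuousOn f) hX.isSelfAdjoint).symm

lemma trace_cfc_eq_sum_roots_charpoly (hX : X.IsHermitian) (f : ℝ → ℝ) :
    (cfc f X).trace = ((X.charpoly.roots.map fun z => f z.re).sum : ℝ) := by
  rw [trace_cfc hX, hX.roots_charpoly_eq_eigenvalues, Multiset.map_map]
  rfl

lemma trace_cfc_conj_diagonal (U : Matrix.unitaryGroup n ℂ) (p : n → ℝ) (f : ℝ → ℝ) :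
    (cfc f ((U : Matrix n n ℂ) * Matrix.diagonal (fun i => (p i : ℂ)) *
      star (U : Matrix n n ℂ))).trace = ((∑ i, f (p i) : ℝ) : ℂ) := by
  have hD : (Matrix.diagonal fun i => (p i : ℂ)).IsHermitian :=
    Matrix.isHermitian_diagonal_of_self_adjoint _ (funext fun i => Complex.conj_ofReal (p i))
  have hUD : ((U : Matrix n n ℂ) * Matrix.diagonal (fun i => (p i : ℂ)) *
      star (U : Matrix n n ℂ)).IsHermitian :=
    Matrix.isHermitian_mul_mul_conjTranspose (U : Matrix n n ℂ) hD
  rw [trace_cfc_eq_sum_roots_charpoly hUD, Matrix.mul_assoc, Matrix.charpoly_mul_comm,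
    Matrix.mul_assoc, Unitary.coe_star_mul_self, Matrix.mul_one, Matrix.charpoly_diagonal,
    Polynomial.roots_prod _ _ (Finset.prod_ne_zero_iff.mpr fun i _ => Polynomial.X_sub_C_ne_zero _)]
  simp

/-- The transition probabilities `|⟨u i, v j⟩|²` between the eigenbases of two Hermitian
matrices. -/
noncomputable def eigenOverlap (hX : X.IsHermitian) (hY : Y.IsHermitian) (i j : n) : ℝ :=
  ‖(star (hX.eigenvectorUnitary : Matrix n n ℂ) * (hY.eigenvectorUnitary : Matrix n n ℂ)) i j‖ ^ 2

lemma eigenOverlap_nonneg (hX : X.IsHermitian) (hY : Y.IsHermitian) (i j : n) :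
    0 ≤ eigenOverlap hX hY i j :=
  sq_nonneg _

lemma trace_cfc_mul_cfc (hX : X.IsHermitian) (hY : Y.IsHermitian) (f g : ℝ → ℝ) :
    (cfc f X * cfc g Y).trace = ((∑ i, ∑ j, eigenOverlap hX hY i j *
      (f (hX.eigenvalues i) * g (hY.eigenvalues j)) : ℝ) : ℂ) := by
  set U := (hX.eigenvectorUnitary : Matrix n n ℂ) with hU
  set V := (hY.eigenvectorUnitary : Matrix n n ℂ) with hV
  have hcycle : (cfc f X * cfc g Y).trace =
      (Matrix.diagonal (fun i => (f (hX.eigenvalues i) : ℂ)) * ((star U * V) *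
        (Matrix.diagonal (fun j => (g (hY.eigenvalues j) : ℂ)) * (star U * V)ᴴ))).trace := by
    rw [cfc_eq_mul_diagonal_mul_star hX, cfc_eq_mul_diagonal_mul_star hY, Matrix.mul_assoc U,
      Matrix.mul_assoc U, Matrix.trace_mul_comm U]
    simp only [Matrix.conjTranspose_mul, Matrix.star_eq_conjTranspose,
      Matrix.conjTranspose_conjTranspose, Matrix.mul_assoc, ← hU, ← hV]
  rw [hcycle, Matrix.trace]
  push_cast
  refine Finset.sum_congr rfl fun i _ => ?_
  rw [Matrix.diag_apply, Matrix.diagonal_mul, Matrix.mul_apply, Finset.mul_sum]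
  refine Finset.sum_congr rfl fun j _ => ?_
  rw [Matrix.diagonal_mul, Matrix.conjTranspose_apply, eigenOverlap, Complex.ofReal_pow,
    ← Complex.conj_mul', RCLike.star_def]
  ring

lemma sum_eigenOverlap_mul_left (hX : X.IsHermitian) (hY : Y.IsHermitian) (f : ℝ → ℝ) :
    ∑ i, ∑ j, eigenOverlap hX hY i j * f (hX.eigenvalues i) = ∑ i, f (hX.eigenvalues i) := by
  have h := trace_cfc_mul_cfc hX hY f 1
  rw [cfc_one ℝ Y, mul_one, trace_cfc hX] at h
  simpa only [Pi.one_apply, mul_one] using (Complex.ofReal_injective h).symm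

lemma sum_eigenOverlap_mul_right (hX : X.IsHermitian) (hY : Y.IsHermitian) (g : ℝ → ℝ) :
    ∑ i, ∑ j, eigenOverlap hX hY i j * g (hY.eigenvalues j) = ∑ j, g (hY.eigenvalues j) := by
  have h := trace_cfc_mul_cfc hX hY 1 g
  rw [cfc_one ℝ X, one_mul, trace_cfc hY] at h
  simpa only [Pi.one_apply, one_mul] using (Complex.ofReal_injective h).symm

lemma trace_cfc_kronecker {m : Type*} [Fintype m] [DecidableEq m] {Y : Matrix m m ℂ}
    (hX : X.IsHermitian) (hY : Y.IsHermitian) (f : ℝ → ℝ) :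
    (cfc f (X ⊗ₖ Y)).trace =
      ((∑ i, ∑ j, f (hX.eigenvalues i * hY.eigenvalues j) : ℝ) : ℂ) := by
  set U := hX.eigenvectorUnitary with hU
  set V := hY.eigenvectorUnitary with hV
  have hXY : X ⊗ₖ Y = ((U : Matrix n n ℂ) ⊗ₖ (V : Matrix m m ℂ)) *
      Matrix.diagonal (fun k => ((hX.eigenvalues k.1 * hY.eigenvalues k.2 : ℝ) : ℂ)) *
        star ((U : Matrix n n ℂ) ⊗ₖ (V : Matrix m m ℂ)) := by
    conv_lhs => rw [eq_mul_diagonal_mul_star hX, eq_mul_diagonal_mul_star hY]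
    simp only [Matrix.mul_kronecker_mul, Matrix.diagonal_kronecker_diagonal,
      Matrix.star_eq_conjTranspose, Matrix.conjTranspose_kronecker, Complex.ofReal_mul, hU, hV]
  rw [hXY]
  refine (trace_cfc_conj_diagonal ⟨_, Matrix.kronecker_mem_unitary U.2 V.2⟩ _ f).trans ?_
  rw [Fintype.sum_prod_type]

lemma trace_cfc_submatrix_equiv {m : Type*} [Fintype m] [DecidableEq m] (hX : X.IsHermitian)
    (e : m ≃ n) (f : ℝ → ℝ) : (cfc f (X.submatrix e e)).trace = (cfc f X).trace := by
  rw [trace_cfc_eq_sum_roots_charpoly (hX.submatrix e), trace_cfc_eq_sum_roots_charpoly hX,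
    ← X.charpoly_reindex e.symm]
  rfl

lemma norm_apply_le_norm (K : Matrix n n ℂ) (i j : n) : ‖K i j‖ ≤ ‖K‖ := by
  have h := K.l2_opNorm_mulVec (EuclideanSpace.single j 1)
  rw [PiLp.norm_single, norm_one, mul_one] at h
  refine le_trans ?_ h
  simpa using PiLp.norm_apply_le ((EuclideanSpace.equiv n ℂ).symm
    (K *ᵥ (EuclideanSpace.single j (1 : ℂ)).ofLp)) i

lemma trace_abs_eq_sum_abs_eigenvalues (hX : X.IsHermitian) :
    (CFC.abs X).trace = ((∑ i, |hX.eigenvalues i| : ℝ) : ℂ) := by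
  rw [CFC.abs_eq_cfc_norm X hX]
  exact trace_cfc hX _

lemma norm_trace_mul_le (hX : X.IsHermitian) (K : Matrix n n ℂ) :
    ‖(X * K).trace‖ ≤ (CFC.abs X).trace.re * ‖K‖ := by
  rw [trace_mul_eq_sum_eigenvalues hX, trace_abs_eq_sum_abs_eigenvalues hX, Complex.ofReal_re,
    Finset.sum_mul]
  refine norm_sum_le_of_le _ fun i _ => ?_
  rw [norm_mul, Complex.norm_real, Real.norm_eq_abs]
  gcongr
  refine (norm_apply_le_norm _ i i).trans_eq ?_
  rw [CStarRing.norm_mul_coe_unitary, ← Unitary.coe_star, CStarRing.norm_coe_unitary_mul]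

end SpectralSums

section TwoPositive

variable {m n : Type*}

/-- A linear map between matrix algebras is two-positive if its entrywise application to `2 × 2`
block matrices preserves positive semidefiniteness. -/
def IsTwoPositive (R : Matrix m m ℂ →ₗ[ℂ] Matrix n n ℂ) : Prop :=
  ∀ A B C D : Matrix m m ℂ, (Matrix.fromBlocks A B C D).PosSemidef →
    (Matrix.fromBlocks (R A) (R B) (R C) (R D)).PosSemidef

variable {R : Matrix m m ℂ →ₗ[ℂ] Matrix n n ℂ}

lemma posSemidef_fromBlocks_mul [Fintype m] {ρ : Matrix m m ℂ} (hρ : ρ.PosSemidef)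
    (X : Matrix m m ℂ) : (Matrix.fromBlocks ρ (ρ * X) (Xᴴ * ρ) (Xᴴ * ρ * X)).PosSemidef := by
  classical
  have h := hρ.conjTranspose_mul_mul_same (Matrix.fromCols (1 : Matrix m m ℂ) X)
  rwa [Matrix.conjTranspose_fromCols_eq_fromRows_conjTranspose, Matrix.conjTranspose_one,
    Matrix.fromRows_mul, Matrix.fromRows_mul_fromCols, Matrix.mul_one, Matrix.one_mul,
    Matrix.mul_one] at h

lemma IsTwoPositive.posSemidef_map [Finite m] (hR : IsTwoPositive R) {X : Matrix m m ℂ}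
    (hX : X.PosSemidef) : (R X).PosSemidef := by
  have := Fintype.ofFinite m
  exact (hR _ _ _ _ (posSemidef_fromBlocks_mul hX 0)).submatrix Sum.inl

lemma IsTwoPositive.map_conjTranspose [Finite m] (hR : IsTwoPositive R) (X : Matrix m m ℂ) :
    R Xᴴ = (R X)ᴴ := by
  classical
  have := Fintype.ofFinite m
  have hblock := posSemidef_fromBlocks_mul Matrix.PosSemidef.one X
  rw [Matrix.one_mul, Matrix.mul_one] at hblock
  exact (Matrix.isHermitian_fromBlocks_iff.mp (hR _ _ _ _ hblock).isHermitian).2.1.symm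

end TwoPositive

section CompletelyPositive

lemma star_ofMatrix_mul_ofMatrix {n : Type*} [Fintype n] (A B C D : Matrix n n ℂ) :
    star (CStarMatrix.ofMatrix !![A, B; C, D]) * CStarMatrix.ofMatrix !![A, B; C, D] =
      CStarMatrix.ofMatrix !![Aᴴ * A + Cᴴ * C, Aᴴ * B + Cᴴ * D;
        Bᴴ * A + Dᴴ * C, Bᴴ * B + Dᴴ * D] := by
  ext i j : 2
  rw [CStarMatrix.mul_apply, Fin.sum_univ_two]
  fin_cases i <;> fin_cases j <;> rfl

variable {m n : Type*} [Fintype m] [DecidableEq m] [Fintype n] [DecidableEq n]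

/-- Stated for an abstract C⋆-algebra, where instance search finds the functional calculus; on
`CStarMatrix` it does not. -/
lemma nonneg_iff_exists_eq_star_mul_self {A : Type*} [CStarAlgebra A] [PartialOrder A]
    [StarOrderedRing A] {a : A} : 0 ≤ a ↔ ∃ b, a = star b * b :=
  CStarAlgebra.nonneg_iff_eq_star_mul_self

lemma posSemidef_fromBlocks_iff_nonneg {A B C D : Matrix n n ℂ} :
    (Matrix.fromBlocks A B C D).PosSemidef ↔
      0 ≤ (CStarMatrix.ofMatrix !![A, B; C, D] : CStarMatrix (Fin 2) (Fin 2) (Matrix n n ℂ)) := by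
  rw [← Matrix.nonneg_iff_posSemidef, nonneg_iff_exists_eq_star_mul_self,
    nonneg_iff_exists_eq_star_mul_self]
  constructor
  · rintro ⟨S, hS⟩
    refine ⟨CStarMatrix.ofMatrix !![S.toBlocks₁₁, S.toBlocks₁₂; S.toBlocks₂₁, S.toBlocks₂₂], ?_⟩
    rw [← S.fromBlocks_toBlocks, Matrix.star_eq_conjTranspose, Matrix.fromBlocks_conjTranspose,
      Matrix.fromBlocks_multiply, Matrix.fromBlocks_inj] at hS
    obtain ⟨rfl, rfl, rfl, rfl⟩ := hS
    exact (star_ofMatrix_mul_ofMatrix _ _ _ _).symm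
  · rintro ⟨N, hN⟩
    refine ⟨Matrix.fromBlocks (N 0 0) (N 0 1) (N 1 0) (N 1 1), ?_⟩
    rw [show N = CStarMatrix.ofMatrix !![N 0 0, N 0 1; N 1 0, N 1 1] from
        Matrix.eta_fin_two (CStarMatrix.ofMatrix.symm N), star_ofMatrix_mul_ofMatrix] at hN
    rw [Matrix.star_eq_conjTranspose, Matrix.fromBlocks_conjTranspose,
      Matrix.fromBlocks_multiply, Matrix.fromBlocks_inj]
    exact ⟨congrFun₂ hN 0 0, congrFun₂ hN 0 1, congrFun₂ hN 1 0, congrFun₂ hN 1 1⟩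

lemma isTwoPositive_of_completelyPositive (R : Matrix m m ℂ →CP Matrix n n ℂ) :
    IsTwoPositive (R : Matrix m m ℂ →ₗ[ℂ] Matrix n n ℂ) := by
  intro A B C D h
  rw [posSemidef_fromBlocks_iff_nonneg] at h ⊢
  convert R.map_cstarMatrix_nonneg _ h
  ext i j
  fin_cases i <;> fin_cases j <;> rfl

end CompletelyPositive

section HeisenbergDual

variable {m n : Type*} [DecidableEq m] [Fintype n]

/-- The dual of `R` for the trace pairing, i.e. `R` in the Heisenberg picture. -/
noncomputable def heisenbergDual (R : Matrix m m ℂ →ₗ[ℂ] Matrix n n ℂ) (Y : Matrix n n ℂ) :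
    Matrix m m ℂ :=
  Matrix.of fun a b => (R (Matrix.single b a 1) * Y).trace

variable {R : Matrix m m ℂ →ₗ[ℂ] Matrix n n ℂ}

lemma heisenbergDual_conjTranspose [Finite m] (hR : IsTwoPositive R) (Y : Matrix n n ℂ) :
    heisenbergDual R Yᴴ = (heisenbergDual R Y)ᴴ := by
  ext a b
  rw [Matrix.conjTranspose_apply, heisenbergDual, heisenbergDual, Matrix.of_apply, Matrix.of_apply,
    ← Matrix.trace_conjTranspose, Matrix.conjTranspose_mul, ← hR.map_conjTranspose,
    Matrix.conjTranspose_single, star_one, Matrix.trace_mul_comm]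

variable [Fintype m]

lemma trace_mul_heisenbergDual (X : Matrix m m ℂ) (Y : Matrix n n ℂ) :
    (X * heisenbergDual R Y).trace = (R X * Y).trace := by
  have hsingle (i j : m) : (R (Matrix.single i j (X i j)) * Y).trace =
      X i j * heisenbergDual R Y j i := by
    have hscale : Matrix.single i j (X i j) = X i j • Matrix.single i j (1 : ℂ) := by simp
    rw [hscale, map_smul, Matrix.smul_mul, Matrix.trace_smul]
    rfl
  conv_rhs => rw [Matrix.matrix_eq_sum_single X]
  simp only [map_sum, Finset.sum_mul, Matrix.trace_sum, hsingle]
  simp only [Matrix.trace, Matrix.diag_apply, Matrix.mul_apply]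

lemma trace_mul_heisenbergDual_mul_conjTranspose_le (hR : IsTwoPositive R)
    (hR_trace : ∀ X, (R X).trace = X.trace) {ρ : Matrix m m ℂ} (hρ : ρ.PosSemidef)
    (Y : Matrix n n ℂ) :
    (ρ * (heisenbergDual R Y * (heisenbergDual R Y)ᴴ)).trace.re ≤ (R ρ * (Y * Yᴴ)).trace.re := by
  classical
  set X := heisenbergDual R Y with hX
  have hcompress := (hR _ _ _ _ (posSemidef_fromBlocks_mul hρ X)).conjTranspose_mul_mul_same
    (Matrix.fromRows Y (-1 : Matrix n n ℂ))
  rw [Matrix.conjTranspose_fromRows_eq_fromCols_conjTranspose, Matrix.mul_assoc,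
    Matrix.fromBlocks_mul_fromRows, Matrix.fromCols_mul_fromRows, Matrix.conjTranspose_neg,
    Matrix.conjTranspose_one] at hcompress
  have hdiag : (R (Xᴴ * ρ * X)).trace = (ρ * (X * Xᴴ)).trace := by
    rw [hR_trace, Matrix.mul_assoc, Matrix.trace_mul_comm, Matrix.mul_assoc]
  have hoff : (R (ρ * X) * Yᴴ).trace = (ρ * (X * Xᴴ)).trace := by
    rw [← trace_mul_heisenbergDual, heisenbergDual_conjTranspose hR, ← hX, Matrix.mul_assoc]
  have hoff' : (R (Xᴴ * ρ) * Y).trace = (ρ * (X * Xᴴ)).trace := by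
    rw [← trace_mul_heisenbergDual, ← hX, Matrix.mul_assoc, Matrix.trace_mul_comm, Matrix.mul_assoc]
  have hcorner : (Yᴴ * (R ρ * Y)).trace = (R ρ * (Y * Yᴴ)).trace := by
    rw [Matrix.trace_mul_comm, Matrix.mul_assoc]
  have htrace := (Complex.nonneg_iff.mp hcompress.trace_nonneg).1
  simp only [Matrix.mul_add, Matrix.mul_neg, Matrix.neg_mul, Matrix.mul_one, Matrix.one_mul,
    neg_neg, Matrix.trace_add, Matrix.trace_neg, Matrix.trace_mul_comm Yᴴ (R (ρ * X)), hcorner,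
    hoff, hoff', hdiag, Complex.add_re, Complex.neg_re] at htrace
  linarith

end HeisenbergDual

section ModularForm

variable {m n : Type*} [Fintype m] [DecidableEq m] [Fintype n]

/-- The quadratic form `2 Re ⟨τ^½, ψ⟩ - ⟨ψ, (t + Δ) ψ⟩` at `ψ = X τ^½`, where `Δ = ρ ⊗ τ⁻¹` is the
relative modular operator of `ρ` and `τ`. Its maximum is the resolvent `⟨τ^½, (t + Δ)⁻¹ τ^½⟩`, but
unlike the resolvent it is affine in `τ` and `ρ`. -/
noncomputable def modularForm (t : ℝ) (τ ρ X : Matrix n n ℂ) : ℝ :=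
  2 * (τ * X).trace.re - (ρ * (X * Xᴴ)).trace.re - t * (τ * (Xᴴ * X)).trace.re

lemma modularForm_map_le {R : Matrix m m ℂ →ₗ[ℂ] Matrix n n ℂ} (hR : IsTwoPositive R)
    (hR_trace : ∀ X, (R X).trace = X.trace) {τ ρ : Matrix m m ℂ} (hτ : τ.PosSemidef)
    (hρ : ρ.PosSemidef) {t : ℝ} (ht : 0 ≤ t) (Y : Matrix n n ℂ) :
    modularForm t (R τ) (R ρ) Y ≤ modularForm t τ ρ (heisenbergDual R Y) := by
  have hleft := trace_mul_heisenbergDual_mul_conjTranspose_le hR hR_trace hρ Y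
  have hright := trace_mul_heisenbergDual_mul_conjTranspose_le hR hR_trace hτ Yᴴ
  rw [heisenbergDual_conjTranspose hR, Matrix.conjTranspose_conjTranspose,
    Matrix.conjTranspose_conjTranspose] at hright
  rw [modularForm, modularForm, trace_mul_heisenbergDual]
  linarith [mul_le_mul_of_nonneg_left hright ht]

variable [DecidableEq n] {τ ρ : Matrix n n ℂ}

lemma modularForm_eq_sum (hτ : τ.IsHermitian) (hρ : ρ.IsHermitian) (t : ℝ) (X : Matrix n n ℂ) :
    modularForm t τ ρ X = ∑ i, ∑ j,
      (2 * hτ.eigenvalues i *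
          ((star (hτ.eigenvectorUnitary : Matrix n n ℂ) * hρ.eigenvectorUnitary) i j *
            (star (hρ.eigenvectorUnitary : Matrix n n ℂ) * X * hτ.eigenvectorUnitary) j i).re -
        (hρ.eigenvalues j + t * hτ.eigenvalues i) *
          ‖(star (hρ.eigenvectorUnitary : Matrix n n ℂ) * X * hτ.eigenvectorUnitary) j i‖ ^ 2) := by
  set U := (hτ.eigenvectorUnitary : Matrix n n ℂ) with hU
  set V := (hρ.eigenvectorUnitary : Matrix n n ℂ) with hV
  have hUU (A : Matrix n n ℂ) : U * (star U * A) = A := by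
    rw [← Matrix.mul_assoc, Unitary.mul_star_self_of_mem hτ.eigenvectorUnitary.2, Matrix.one_mul]
  have hVV (A : Matrix n n ℂ) : V * (star V * A) = A := by
    rw [← Matrix.mul_assoc, Unitary.mul_star_self_of_mem hρ.eigenvectorUnitary.2, Matrix.one_mul]
  set Z := star V * X * U with hZ
  have hlinear : star U * X * U = (star U * V) * Z := by
    simp only [hZ, Matrix.mul_assoc, hVV]
  have hleft : star V * (X * Xᴴ) * V = Z * Zᴴ := by
    simp only [hZ, Matrix.conjTranspose_mul, Matrix.star_eq_conjTranspose,
      Matrix.conjTranspose_conjTranspose, Matrix.mul_assoc]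
    rw [← Matrix.star_eq_conjTranspose U, hUU]
  have hright : star U * (Xᴴ * X) * U = Zᴴ * Z := by
    simp only [hZ, Matrix.conjTranspose_mul, Matrix.star_eq_conjTranspose,
      Matrix.conjTranspose_conjTranspose, Matrix.mul_assoc]
    rw [← Matrix.star_eq_conjTranspose V, hVV]
  rw [modularForm, trace_mul_eq_sum_eigenvalues hτ X, trace_mul_eq_sum_eigenvalues hρ,
    trace_mul_eq_sum_eigenvalues hτ, ← hU, ← hV, hlinear, hleft, hright]
  simp only [Matrix.mul_apply (N := Z), Matrix.mul_apply (M := Z), Matrix.conjTranspose_apply,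
    RCLike.star_def, Complex.mul_conj', Complex.conj_mul', Complex.re_sum, Complex.re_ofReal_mul,
    ← Complex.ofReal_pow, Complex.ofReal_re, Finset.mul_sum, Finset.sum_sub_distrib, add_mul,
    Finset.sum_add_distrib, mul_assoc]
  rw [Finset.sum_comm (f := fun j i => hρ.eigenvalues j * ‖Z j i‖ ^ 2)]
  ring

/-- The resolvent `⟨τ^½, (t + Δ)⁻¹ τ^½⟩` of the relative modular operator `Δ` of `ρ` and `τ`,
written in the eigenbases of `τ` and `ρ`. -/
noncomputable def modularResolvent (hτ : τ.IsHermitian) (hρ : ρ.IsHermitian) (t : ℝ) : ℝ :=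
  ∑ i, ∑ j, eigenOverlap hτ hρ i j *
    (hτ.eigenvalues i ^ 2 / (hρ.eigenvalues j + t * hτ.eigenvalues i))

lemma two_mul_re_mul_sub_le (p : ℝ) {d : ℝ} (hd : 0 < d) (w z : ℂ) :
    2 * p * (w * z).re - d * ‖z‖ ^ 2 ≤ ‖w‖ ^ 2 * (p ^ 2 / d) := by
  rw [← mul_div_assoc, le_div_iff₀ hd, Complex.sq_norm, Complex.sq_norm, Complex.normSq_apply,
    Complex.normSq_apply, Complex.mul_re]
  nlinarith [sq_nonneg (p * w.re - d * z.re), sq_nonneg (p * w.im + d * z.im)]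

lemma two_mul_re_mul_sub_eq (p : ℝ) {d : ℝ} (hd : 0 < d) (w : ℂ) :
    2 * p * (w * ((p / d : ℝ) * star w)).re - d * ‖((p / d : ℝ) : ℂ) * star w‖ ^ 2 =
      ‖w‖ ^ 2 * (p ^ 2 / d) := by
  rw [mul_left_comm, RCLike.star_def, Complex.mul_conj', ← Complex.ofReal_pow,
    ← Complex.ofReal_mul, Complex.ofReal_re, norm_mul, RCLike.norm_conj, Complex.norm_real,
    Real.norm_eq_abs, mul_pow, sq_abs]
  field_simp
  ring

lemma isGreatest_modularResolvent (hτ : τ.PosSemidef) (hρ : ρ.PosDef) {t : ℝ} (ht : 0 ≤ t) :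
    IsGreatest (Set.range (modularForm t τ ρ))
      (modularResolvent hτ.isHermitian hρ.isHermitian t) := by
  have hpos (i j : n) :
      0 < hρ.isHermitian.eigenvalues j + t * hτ.isHermitian.eigenvalues i :=
    add_pos_of_pos_of_nonneg (hρ.eigenvalues_pos j) (mul_nonneg ht (hτ.eigenvalues_nonneg i))
  constructor
  · set W := star (hτ.isHermitian.eigenvectorUnitary : Matrix n n ℂ) *
      (hρ.isHermitian.eigenvectorUnitary : Matrix n n ℂ)
    set Z : Matrix n n ℂ := Matrix.of fun j i => ((hτ.isHermitian.eigenvalues i /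
      (hρ.isHermitian.eigenvalues j + t * hτ.isHermitian.eigenvalues i) : ℝ) : ℂ) * star (W i j)
    refine ⟨(hρ.isHermitian.eigenvectorUnitary : Matrix n n ℂ) * Z *
      star (hτ.isHermitian.eigenvectorUnitary : Matrix n n ℂ), ?_⟩
    rw [modularForm_eq_sum hτ.isHermitian hρ.isHermitian, ← Matrix.mul_assoc, ← Matrix.mul_assoc,
      Unitary.coe_star_mul_self, Matrix.one_mul, Matrix.mul_assoc, Unitary.coe_star_mul_self,
      Matrix.mul_one]
    exact Finset.sum_congr rfl fun i _ => Finset.sum_congr rfl fun j _ =>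
      two_mul_re_mul_sub_eq _ (hpos i j) _
  · rintro _ ⟨X, rfl⟩
    rw [modularForm_eq_sum hτ.isHermitian hρ.isHermitian]
    exact Finset.sum_le_sum fun i _ => Finset.sum_le_sum fun j _ =>
      two_mul_re_mul_sub_le _ (hpos i j) _ _

lemma modularResolvent_map_le {R : Matrix m m ℂ →ₗ[ℂ] Matrix n n ℂ} (hR : IsTwoPositive R)
    (hR_trace : ∀ X, (R X).trace = X.trace) {τ ρ : Matrix m m ℂ} (hτ : τ.PosSemidef)
    (hρ : ρ.PosDef) (hRρ : (R ρ).PosDef) {t : ℝ} (ht : 0 ≤ t) :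
    modularResolvent (hR.posSemidef_map hτ).isHermitian hRρ.isHermitian t ≤
      modularResolvent hτ.isHermitian hρ.isHermitian t := by
  obtain ⟨Y, hY⟩ := (isGreatest_modularResolvent (hR.posSemidef_map hτ) hRρ ht).1
  rw [← hY]
  exact (modularForm_map_le hR hR_trace hτ hρ.posSemidef ht Y).trans
    ((isGreatest_modularResolvent hτ hρ ht).2 ⟨_, rfl⟩)

end ModularForm

section RelativeEntropy

open Filter Topology

variable {n : Type*} [Fintype n] [DecidableEq n] {τ ρ : Matrix n n ℂ}

/-- The quantum relative entropy `Tr[τ (log τ - log ρ)]`. It has its usual meaning for positive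
definite `ρ`: the convention `log 0 = 0` would make it finite also when the kernel of `ρ` is not
contained in that of `τ`. -/
noncomputable def relEntropy (τ ρ : Matrix n n ℂ) : ℝ :=
  (τ * (CFC.log τ - CFC.log ρ)).trace.re

lemma re_trace_mul_cfc (hτ : τ.IsHermitian) (hρ : ρ.IsHermitian) (g : ℝ → ℝ) :
    (τ * cfc g ρ).trace.re =
      ∑ i, ∑ j, eigenOverlap hτ hρ i j * (hτ.eigenvalues i * g (hρ.eigenvalues j)) := by
  have h := trace_cfc_mul_cfc hτ hρ id g
  rw [cfc_id ℝ τ hτ.isSelfAdjoint] at h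
  rw [h, Complex.ofReal_re]
  rfl

lemma re_trace_mul_cfc_self (hτ : τ.IsHermitian) (g : ℝ → ℝ) :
    (τ * cfc g τ).trace.re = ∑ i, hτ.eigenvalues i * g (hτ.eigenvalues i) := by
  have h := cfc_mul_cfc τ id g
  rw [cfc_id ℝ τ hτ.isSelfAdjoint] at h
  rw [h, trace_cfc hτ, Complex.ofReal_re]
  rfl

lemma re_trace_eq_sum_eigenvalues (hτ : τ.IsHermitian) :
    τ.trace.re = ∑ i, hτ.eigenvalues i := by
  simpa using congrArg Complex.re hτ.trace_eq_sum_eigenvalues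

lemma relEntropy_eq_sum (hτ : τ.IsHermitian) (hρ : ρ.IsHermitian) :
    relEntropy τ ρ = ∑ i, ∑ j, eigenOverlap hτ hρ i j *
      (hτ.eigenvalues i * (Real.log (hτ.eigenvalues i) - Real.log (hρ.eigenvalues j))) := by
  rw [relEntropy, CFC.log, CFC.log, Matrix.mul_sub, Matrix.trace_sub, Complex.sub_re,
    re_trace_mul_cfc_self hτ, re_trace_mul_cfc hτ hρ,
    ← sum_eigenOverlap_mul_left hτ hρ (fun x => x * Real.log x)]
  simp only [← Finset.sum_sub_distrib, ← mul_sub]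

lemma sub_le_mul_log_sub_log {p q : ℝ} (hp : 0 ≤ p) (hq : 0 < q) :
    p - q ≤ p * (Real.log p - Real.log q) := by
  rcases hp.eq_or_lt with rfl | hp
  · simpa using hq.le
  · have h := mul_le_mul_of_nonneg_left (Real.log_le_sub_one_of_pos (div_pos hq hp)) hp.le
    rw [Real.log_div hq.ne' hp.ne', mul_sub p (q / p), mul_div_cancel₀ _ hp.ne'] at h
    linarith

/-- **Klein's inequality**. -/
lemma relEntropy_nonneg (hτ : τ.PosSemidef) (hρ : ρ.PosDef) (h : ρ.trace.re ≤ τ.trace.re) :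
    0 ≤ relEntropy τ ρ := by
  rw [relEntropy_eq_sum hτ.isHermitian hρ.isHermitian]
  calc 0 ≤ τ.trace.re - ρ.trace.re := sub_nonneg.mpr h
    _ = ∑ i, ∑ j, eigenOverlap hτ.isHermitian hρ.isHermitian i j *
        (hτ.isHermitian.eigenvalues i - hρ.isHermitian.eigenvalues j) := by
      simp only [mul_sub, Finset.sum_sub_distrib]
      rw [re_trace_eq_sum_eigenvalues hτ.isHermitian, re_trace_eq_sum_eigenvalues hρ.isHermitian,
        sum_eigenOverlap_mul_left _ _ fun x => x, sum_eigenOverlap_mul_right _ _ fun x => x]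
    _ ≤ _ := Finset.sum_le_sum fun i _ => Finset.sum_le_sum fun j _ =>
      mul_le_mul_of_nonneg_left
        (sub_le_mul_log_sub_log (hτ.eigenvalues_nonneg i) (hρ.eigenvalues_pos j))
        (eigenOverlap_nonneg _ _ i j)

/-- The integral of `modularResolvent hτ hρ` over `[0, T]`, in closed form. -/
noncomputable def modularResolventIntegral (hτ : τ.IsHermitian) (hρ : ρ.IsHermitian) (T : ℝ) : ℝ :=
  ∑ i, ∑ j, eigenOverlap hτ hρ i j * (hτ.eigenvalues i *
    (Real.log (hρ.eigenvalues j + T * hτ.eigenvalues i) - Real.log (hρ.eigenvalues j)))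

lemma modularResolventIntegral_zero (hτ : τ.IsHermitian) (hρ : ρ.IsHermitian) :
    modularResolventIntegral hτ hρ 0 = 0 := by
  simp [modularResolventIntegral]

lemma hasDerivAt_modularResolventIntegral (hτ : τ.PosSemidef) (hρ : ρ.PosDef) {T : ℝ}
    (hT : 0 ≤ T) :
    HasDerivAt (modularResolventIntegral hτ.isHermitian hρ.isHermitian)
      (modularResolvent hτ.isHermitian hρ.isHermitian T) T := by
  refine HasDerivAt.fun_sum fun i _ => HasDerivAt.fun_sum fun j _ => HasDerivAt.const_mul _ ?_
  set p := hτ.isHermitian.eigenvalues i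
  set q := hρ.isHermitian.eigenvalues j
  have hpos : 0 < q + T * p :=
    add_pos_of_pos_of_nonneg (hρ.eigenvalues_pos j) (mul_nonneg hT (hτ.eigenvalues_nonneg i))
  have hlin : HasDerivAt (fun T => q + T * p) p T := by
    simpa using ((hasDerivAt_id T).mul_const p).const_add q
  refine (((hlin.log hpos.ne').sub_const (Real.log q)).const_mul p).congr_deriv ?_
  rw [← mul_div_assoc, pow_two]

lemma tendsto_mul_log_add_mul_sub {p q : ℝ} (hp : 0 ≤ p) (hq : 0 < q) :
    Tendsto (fun T : ℝ => p * (Real.log (q + T * p) - Real.log q) - p * Real.log T) atTop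
      (𝓝 (p * (Real.log p - Real.log q))) := by
  rcases hp.eq_or_lt with rfl | hp
  · simp
  have hlim : Tendsto (fun T : ℝ => q / T + p) atTop (𝓝 p) := by
    simpa using (tendsto_const_nhds.div_atTop tendsto_id).add_const p
  refine (((hlim.log hp.ne').sub_const (Real.log q)).const_mul p).congr' ?_
  filter_upwards [eventually_gt_atTop 0] with T hT
  rw [show q / T + p = (q + T * p) / T by field_simp, Real.log_div (by positivity) hT.ne']
  ring

lemma tendsto_modularResolventIntegral (hτ : τ.PosSemidef) (hρ : ρ.PosDef) :
    Tendsto (fun T => modularResolventIntegral hτ.isHermitian hρ.isHermitian T -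
      τ.trace.re * Real.log T) atTop (𝓝 (relEntropy τ ρ)) := by
  rw [relEntropy_eq_sum hτ.isHermitian hρ.isHermitian]
  refine (tendsto_finsetSum _ fun i _ => tendsto_finsetSum _ fun j _ =>
    (tendsto_mul_log_add_mul_sub (hτ.eigenvalues_nonneg i)
      (hρ.eigenvalues_pos j)).const_mul _).congr fun T => ?_
  rw [re_trace_eq_sum_eigenvalues hτ.isHermitian, Finset.sum_mul,
    ← sum_eigenOverlap_mul_left hτ.isHermitian hρ.isHermitian fun x => x * Real.log T,
    modularResolventIntegral]
  simp only [mul_sub, Finset.sum_sub_distrib]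

end RelativeEntropy

section DataProcessing

open Filter

variable {m n : Type*} [Fintype m] [DecidableEq m] [Fintype n] [DecidableEq n]
  {R : Matrix m m ℂ →ₗ[ℂ] Matrix n n ℂ} {τ ρ : Matrix m m ℂ}

lemma modularResolventIntegral_map_le (hR : IsTwoPositive R)
    (hR_trace : ∀ X, (R X).trace = X.trace) (hτ : τ.PosSemidef) (hρ : ρ.PosDef)
    (hRρ : (R ρ).PosDef) {T : ℝ} (hT : 0 ≤ T) :
    modularResolventIntegral (hR.posSemidef_map hτ).isHermitian hRρ.isHermitian T ≤
      modularResolventIntegral hτ.isHermitian hρ.isHermitian T := by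
  have hderiv (S : ℝ) (hS : 0 ≤ S) := (hasDerivAt_modularResolventIntegral hτ hρ hS).fun_sub
    (hasDerivAt_modularResolventIntegral (hR.posSemidef_map hτ) hRρ hS)
  have hmono := monotoneOn_of_hasDerivWithinAt_nonneg (convex_Ici (0 : ℝ))
    (fun S hS => (hderiv S hS).continuousAt.continuousWithinAt)
    (fun S hS => (hderiv S (interior_subset hS)).hasDerivWithinAt)
    (fun S hS => sub_nonneg.mpr
      (modularResolvent_map_le hR hR_trace hτ hρ hRρ (interior_subset hS)))
  simpa only [modularResolventIntegral_zero, sub_zero, sub_nonneg] using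
    hmono Set.self_mem_Ici hT hT

/-- The **data processing inequality**, which rests on
`Tr[τ (log τ - log ρ)] = lim_{T → ∞} (∫₀ᵀ modularResolvent - Tr[τ] log T)`. -/
theorem relEntropy_map_le (hR : IsTwoPositive R) (hR_trace : ∀ X, (R X).trace = X.trace)
    (hτ : τ.PosSemidef) (hρ : ρ.PosDef) (hRρ : (R ρ).PosDef) :
    relEntropy (R τ) (R ρ) ≤ relEntropy τ ρ := by
  refine le_of_tendsto_of_tendsto
    (tendsto_modularResolventIntegral (hR.posSemidef_map hτ) hRρ)
    (tendsto_modularResolventIntegral hτ hρ) ?_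
  filter_upwards [eventually_ge_atTop 0] with T hT
  rw [hR_trace]
  gcongr
  exact modularResolventIntegral_map_le hR hR_trace hτ hρ hRρ hT

end DataProcessing

section TraceNorm

variable {Λ : Type*} [Fintype Λ] [DecidableEq Λ] {X σ : QubitOp Λ}

lemma traceNorm_eq_sum_abs_eigenvalues (hX : X.IsHermitian) :
    traceNorm X = ∑ i, |hX.eigenvalues i| := by
  rw [traceNorm, trace_abs_eq_sum_abs_eigenvalues hX, Complex.ofReal_re]

lemma traceNorm_nonneg (hX : X.IsHermitian) : 0 ≤ traceNorm X := by
  rw [traceNorm_eq_sum_abs_eigenvalues hX]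
  positivity

lemma traceNorm_eq_zero_iff (hX : X.IsHermitian) : traceNorm X = 0 ↔ X = 0 := by
  rw [traceNorm_eq_sum_abs_eigenvalues hX, ← hX.eigenvalues_eq_zero_iff,
    Finset.sum_eq_zero_iff_of_nonneg fun i _ => abs_nonneg _, funext_iff]
  simp only [Finset.mem_univ, forall_const, abs_eq_zero, Pi.zero_apply]

lemma IsQuantumState.sum_eigenvalues (hσ : IsQuantumState σ) :
    ∑ i, hσ.1.isHermitian.eigenvalues i = 1 := by
  rw [← re_trace_eq_sum_eigenvalues, hσ.2, Complex.one_re]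

lemma IsQuantumState.traceNorm_eq_one (hσ : IsQuantumState σ) : traceNorm σ = 1 := by
  rw [traceNorm_eq_sum_abs_eigenvalues hσ.1.isHermitian, ← hσ.sum_eigenvalues]
  exact Finset.sum_congr rfl fun i _ => abs_of_nonneg (hσ.1.eigenvalues_nonneg i)

lemma abs_re_trace_mul_le (hX : X.IsHermitian) (K : QubitOp Λ) :
    |(X * K).trace.re| ≤ traceNorm X * ‖K‖ :=
  (Complex.abs_re_le_norm _).trans (norm_trace_mul_le hX K)

lemma IsQuantumState.abs_re_trace_mul_le (hσ : IsQuantumState σ) (K : QubitOp Λ) :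
    |(σ * K).trace.re| ≤ ‖K‖ := by
  simpa only [hσ.traceNorm_eq_one, one_mul] using _root_.abs_re_trace_mul_le hσ.1.isHermitian K

/-- Shifting `f` by the midpoint of `[a, b]` does not change the trace and gains a factor `2`. -/
lemma abs_re_trace_mul_cfc_le_of_trace_eq_zero (hX : X.IsHermitian) (hX_trace : X.trace = 0)
    {Y : QubitOp Λ} (hY : Y.IsHermitian) {f : ℝ → ℝ} {a b : ℝ}
    (hf : ∀ i, f (hY.eigenvalues i) ∈ Set.Icc a b) :
    |(X * cfc f Y).trace.re| ≤ traceNorm X * ((b - a) / 2) := by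
  have hshift : cfc (fun x => f x - (a + b) / 2) Y = cfc f Y - algebraMap ℝ _ ((a + b) / 2) :=
    (cfc_sub f _ Y (Y.finite_real_spectrum.continuousOn f)).trans
      (congrArg (cfc f Y - ·) (cfc_const _ Y hY.isSelfAdjoint))
  have htrace : (X * cfc f Y).trace = (X * cfc (fun x => f x - (a + b) / 2) Y).trace := by
    rw [hshift, Algebra.algebraMap_eq_smul_one, Matrix.mul_sub, Matrix.mul_smul, Matrix.mul_one,
      Matrix.trace_sub, Matrix.trace_smul, hX_trace, smul_zero, sub_zero]
  have hab : a ≤ b := (hf fun _ => 0).1.trans (hf fun _ => 0).2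
  rw [htrace]
  refine (abs_re_trace_mul_le hX _).trans
    (mul_le_mul_of_nonneg_left (norm_cfc_le (by linarith) ?_) (traceNorm_nonneg hX))
  rw [hY.spectrum_real_eq_range_eigenvalues]
  rintro _ ⟨i, rfl⟩
  obtain ⟨ha, hb⟩ := hf i
  rw [Real.norm_eq_abs, abs_le]
  constructor <;> linarith

end TraceNorm

section Entropy

variable {Λ : Type*} [Fintype Λ] [DecidableEq Λ] {ρ σ : QubitOp Λ}

lemma vonNeumannEntropy_eq_sum (hσ : σ.IsHermitian) :
    vonNeumannEntropy σ = ∑ i, Real.negMulLog (hσ.eigenvalues i) := by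
  simp only [vonNeumannEntropy, CFC.log, re_trace_mul_cfc_self hσ, Real.negMulLog_eq_neg,
    Finset.sum_neg_distrib]

lemma relEntropy_eq_neg_vonNeumannEntropy_sub (ρ σ : QubitOp Λ) :
    relEntropy ρ σ = -vonNeumannEntropy ρ - (ρ * CFC.log σ).trace.re := by
  rw [relEntropy, vonNeumannEntropy, Matrix.mul_sub, Matrix.trace_sub, Complex.sub_re, neg_neg]

/-- The eigenvalue of the mixture `(σ + ε • 1 / d) / (1 + ε)` of `σ` with the maximally mixed state
in dimension `d` that belongs to the eigenvalue `x` of `σ`. -/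
noncomputable def smoothedEigenvalue (d ε x : ℝ) : ℝ :=
  (x + ε / d) / (1 + ε)

lemma smoothedEigenvalue_pos {d ε x : ℝ} (hd : 0 < d) (hε : 0 < ε) (hx : 0 ≤ x) :
    0 < smoothedEigenvalue d ε x := by
  rw [smoothedEigenvalue]
  positivity

lemma log_smoothedEigenvalue_mem_Icc {d ε x : ℝ} (hd : 1 ≤ d) (hε : 0 < ε)
    (hx : x ∈ Set.Icc 0 1) :
    Real.log (smoothedEigenvalue d ε x) ∈ Set.Icc (-Real.log (d * (1 + ε) / ε)) 0 := by
  have hd0 : 0 < d := by linarith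
  constructor
  · rw [← Real.log_inv, inv_div, div_mul_eq_div_div]
    refine Real.log_le_log (by positivity) ?_
    rw [smoothedEigenvalue]
    gcongr
    linarith [hx.1]
  · refine Real.log_nonpos (smoothedEigenvalue_pos hd0 hε hx.1).le ?_
    rw [smoothedEigenvalue, div_le_one (by positivity)]
    exact add_le_add hx.2 (div_le_self hε.le hd)

lemma mul_log_sub_log_le_mul_log_smoothedEigenvalue {d ε x : ℝ} (hd : 0 < d) (hε : 0 < ε)
    (hx : 0 ≤ x) :
    x * (Real.log x - Real.log (1 + ε)) ≤ x * Real.log (smoothedEigenvalue d ε x) := by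
  rcases hx.eq_or_lt with rfl | hx
  · simp
  · rw [← Real.log_div hx.ne' (by positivity), smoothedEigenvalue]
    gcongr
    exact le_add_of_nonneg_right (by positivity)

lemma sum_smoothedEigenvalue {ι : Type*} [Fintype ι] [Nonempty ι] {x : ι → ℝ}
    (hx : ∑ i, x i = 1) {ε : ℝ} (hε : 0 < ε) :
    ∑ i, smoothedEigenvalue (Fintype.card ι) ε (x i) = 1 := by
  simp only [smoothedEigenvalue]
  rw [← Finset.sum_div, Finset.sum_add_distrib, hx, Finset.sum_const, Finset.card_univ,
    nsmul_eq_mul, mul_div_cancel₀ _ (Nat.cast_ne_zero.mpr Fintype.card_ne_zero),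
    div_self (by positivity)]

lemma IsQuantumState.vonNeumannEntropy_le_neg_re_trace_mul_log (hρ : IsQuantumState ρ)
    {ω : QubitOp Λ} (hω : ω.PosDef) (hω_trace : ω.trace = 1) :
    vonNeumannEntropy ρ ≤ -(ρ * CFC.log ω).trace.re := by
  have h := relEntropy_nonneg hρ.1 hω (by rw [hω_trace, hρ.2])
  rw [relEntropy_eq_neg_vonNeumannEntropy_sub] at h
  linarith

lemma IsQuantumState.eigenvalues_mem_Icc (hσ : IsQuantumState σ) (i : Λ → Fin 2) :
    hσ.1.isHermitian.eigenvalues i ∈ Set.Icc 0 1 := by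
  refine ⟨hσ.1.eigenvalues_nonneg i, ?_⟩
  rw [← hσ.sum_eigenvalues]
  exact Finset.single_le_sum (fun j _ => hσ.1.eigenvalues_nonneg j) (Finset.mem_univ i)

lemma IsQuantumState.neg_re_trace_mul_log_smoothedEigenvalue_le (hσ : IsQuantumState σ) {d ε : ℝ}
    (hd : 0 < d) (hε : 0 < ε) :
    -(σ * cfc (fun x => Real.log (smoothedEigenvalue d ε x)) σ).trace.re ≤
      vonNeumannEntropy σ + Real.log (1 + ε) := by
  have hsum := Finset.sum_le_sum fun i (_ : i ∈ Finset.univ) =>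
    mul_log_sub_log_le_mul_log_smoothedEigenvalue hd hε (hσ.1.eigenvalues_nonneg i)
  simp only [mul_sub, Finset.sum_sub_distrib, ← Finset.sum_mul, hσ.sum_eigenvalues,
    one_mul] at hsum
  rw [vonNeumannEntropy_eq_sum hσ.1.isHermitian, re_trace_mul_cfc_self hσ.1.isHermitian]
  simp only [Real.negMulLog_eq_neg, Finset.sum_neg_distrib]
  linarith

/-- A **Fannes type continuity bound**, from Klein's inequality for `ρ` and the mixture of `σ` with
a little of the maximally mixed state, whose logarithm is bounded. -/
theorem vonNeumannEntropy_sub_le (hρ : IsQuantumState ρ) (hσ : IsQuantumState σ) {ε : ℝ}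
    (hε : 0 < ε) (h : traceNorm (ρ - σ) ≤ ε) :
    vonNeumannEntropy ρ - vonNeumannEntropy σ ≤
      ε / 2 * Real.log (2 ^ Fintype.card Λ * (1 + ε) / ε) + Real.log (1 + ε) := by
  set d : ℝ := (Fintype.card (Λ → Fin 2) : ℝ) with hd_def
  have hd_eq : d = 2 ^ Fintype.card Λ := by simp [hd_def]
  have hd : 1 ≤ d := hd_eq ▸ one_le_pow₀ one_le_two
  have hd_pos : 0 < d := one_pos.trans_le hd
  set K := cfc (fun x => Real.log (smoothedEigenvalue d ε x)) σ with hK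
  have hS_ρ : vonNeumannEntropy ρ ≤ -(ρ * K).trace.re := by
    rw [hK, ← log_cfc hσ.1.isHermitian]
    refine hρ.vonNeumannEntropy_le_neg_re_trace_mul_log (posDef_cfc hσ.1.isHermitian
      fun i => smoothedEigenvalue_pos hd_pos hε (hσ.1.eigenvalues_nonneg i)) ?_
    rw [trace_cfc hσ.1.isHermitian, sum_smoothedEigenvalue hσ.sum_eigenvalues hε,
      Complex.ofReal_one]
  have hS_σ := hσ.neg_re_trace_mul_log_smoothedEigenvalue_le hd_pos hε
  have hdiff : |((ρ - σ) * K).trace.re| ≤ ε * (Real.log (d * (1 + ε) / ε) / 2) := by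
    have hL := abs_re_trace_mul_cfc_le_of_trace_eq_zero (hρ.1.isHermitian.sub hσ.1.isHermitian)
      (by rw [Matrix.trace_sub, hρ.2, hσ.2, sub_self]) hσ.1.isHermitian
      (f := fun x => Real.log (smoothedEigenvalue d ε x))
      fun i => log_smoothedEigenvalue_mem_Icc hd hε (hσ.eigenvalues_mem_Icc i)
    rw [zero_sub, neg_neg] at hL
    refine hL.trans (mul_le_mul_of_nonneg_right h (div_nonneg (Real.log_nonneg ?_) two_pos.le))
    rw [one_le_div hε]
    nlinarith
  rw [Matrix.sub_mul, Matrix.trace_sub, Complex.sub_re] at hdiff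
  rw [← hd_eq]
  linarith [(abs_le.mp hdiff).1]

lemma log_one_add_div_le {ε M : ℝ} (hε : 0 < ε) (hM : 0 ≤ M) (hεM : Real.log (1 / ε) ≤ M) :
    Real.log ((1 + ε) / ε) ≤ Real.log 2 + M := by
  rw [Real.log_le_iff_le_exp (by positivity)] at hεM ⊢
  rw [Real.exp_add, Real.exp_log two_pos, add_div, div_self hε.ne']
  linarith [Real.one_le_exp hM]

lemma mul_add_fannes_bound_le {ε M E : ℝ} {n : ℕ} (hε : 0 < ε) (hM : 1 ≤ M)
    (hεM : Real.log (1 / ε) ≤ M) (hEM : E ≤ M) (hnM : n ≤ M) :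
    ε * E + (ε / 2 * Real.log (2 ^ n * (1 + ε) / ε) + Real.log (1 + ε)) ≤ 4 * ε * M := by
  have hlog_two : Real.log 2 ≤ 1 := by linarith [Real.log_two_lt_d9]
  have hlog_one_add : Real.log (1 + ε) ≤ ε := by
    linarith [Real.log_le_sub_one_of_pos (show 0 < 1 + ε by linarith)]
  have hlog_dim : Real.log (2 ^ n * (1 + ε) / ε) ≤ 3 * M := by
    rw [mul_div_assoc, Real.log_mul (by positivity) (by positivity), Real.log_pow]
    linarith [log_one_add_div_le hε (by linarith) hεM,
      mul_le_of_le_one_right n.cast_nonneg hlog_two]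
  linarith [mul_le_mul_of_nonneg_left hlog_dim (half_pos hε).le,
    mul_le_mul_of_nonneg_left hEM hε.le, mul_le_mul_of_nonneg_left hM hε.le]

lemma IsQuantumState.eq_of_isEmpty [IsEmpty Λ] (hρ : IsQuantumState ρ) (hσ : IsQuantumState σ) :
    ρ = σ := by
  ext x y
  have h := hρ.2.trans hσ.2.symm
  rw [Matrix.trace, Matrix.trace, Fintype.sum_subsingleton _ x, Fintype.sum_subsingleton _ x] at h
  rwa [Subsingleton.elim y x]

lemma mul_add_vonNeumannEntropy_sub_le (hρ : IsQuantumState ρ) (hσ : IsQuantumState σ) {ε : ℝ}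
    (h : traceNorm (ρ - σ) ≤ ε) (E : ℝ) :
    ε * E + (vonNeumannEntropy ρ - vonNeumannEntropy σ) ≤
      4 * ε * max (Real.log (1 / ε)) (max E (Fintype.card Λ)) := by
  set M := max (Real.log (1 / ε)) (max E (Fintype.card Λ))
  have hEM : E ≤ M := (le_max_left _ _).trans (le_max_right _ _)
  have hcardM : (Fintype.card Λ : ℝ) ≤ M := (le_max_right _ _).trans (le_max_right _ _)
  have hM : 0 ≤ M := (Nat.cast_nonneg _).trans hcardM
  have hρσ : (ρ - σ).IsHermitian := hρ.1.isHermitian.sub hσ.1.isHermitian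
  have hε : 0 ≤ ε := (traceNorm_nonneg hρσ).trans h
  by_cases heq : ρ = σ
  · rw [heq]
    nlinarith [mul_le_mul_of_nonneg_left hEM hε, mul_nonneg hε hM]
  have hε_pos : 0 < ε := lt_of_lt_of_le ((traceNorm_nonneg hρσ).lt_of_ne' fun h0 =>
    heq (sub_eq_zero.mp ((traceNorm_eq_zero_iff hρσ).mp h0))) h
  have hΛ : Nonempty Λ := not_isEmpty_iff.mp fun _ => heq (hρ.eq_of_isEmpty hσ)
  have hM_one : 1 ≤ M := le_trans (by exact_mod_cast Fintype.card_pos) hcardM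
  linarith [vonNeumannEntropy_sub_le hρ hσ hε_pos h,
    mul_add_fannes_bound_le hε_pos hM_one (le_max_left _ _) hEM hcardM]

end Entropy

section Regions

variable {Λ : Type*} [Fintype Λ] [DecidableEq Λ] {A : Finset Λ} {σ τ O : QubitOp Λ}

/-- Restriction to `A` and to its complement identifies a configuration with a pair of
configurations; the inverse is `glue A`. -/
def splitEquiv (A : Finset Λ) : (Λ → Fin 2) ≃ (A → Fin 2) × (↥(Aᶜ) → Fin 2) where
  toFun x := (fun i => x i, fun i => x i)
  invFun a := glue A a.1 a.2
  left_inv x := by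
    funext i
    simp only [glue]
    split_ifs <;> rfl
  right_inv a := by
    refine Prod.ext (funext fun i => ?_) (funext fun i => ?_)
    · simp [glue, i.2]
    · simp [glue, Finset.mem_compl.mp i.2]

lemma regionTensor_eq_submatrix (A : Finset Λ) (X : QubitOp A) (Y : QubitOp ↥(Aᶜ)) :
    regionTensor A X Y = (X ⊗ₖ Y).submatrix (splitEquiv A) (splitEquiv A) :=
  rfl

lemma splitEquiv_glue (A : Finset Λ) (a : A → Fin 2) (z : ↥(Aᶜ) → Fin 2) :
    splitEquiv A (glue A a z) = (a, z) :=
  (splitEquiv A).apply_symm_apply (a, z)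

lemma regionTensor_glue (A : Finset Λ) (X : QubitOp A) (Y : QubitOp ↥(Aᶜ))
    (a b : A → Fin 2) (z w : ↥(Aᶜ) → Fin 2) :
    regionTensor A X Y (glue A a z) (glue A b w) = X a b * Y z w := by
  rw [regionTensor_eq_submatrix, Matrix.submatrix_apply, splitEquiv_glue, splitEquiv_glue,
    Matrix.kroneckerMap_apply]

lemma sum_glue {M : Type*} [AddCommMonoid M] (A : Finset Λ) (f : (Λ → Fin 2) → M) :
    ∑ x, f x = ∑ a, ∑ z, f (glue A a z) := by
  rw [← Fintype.sum_prod_type' fun a z => f (glue A a z)]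
  exact ((splitEquiv A).symm.sum_comp f).symm

lemma marginal_apply (A : Finset Λ) (σ : QubitOp Λ) (x y : A → Fin 2) :
    marginal A σ x y = ∑ z, σ (glue A x z) (glue A y z) :=
  rfl

lemma marginal_compl_apply (A : Finset Λ) (σ : QubitOp Λ) (z w : ↥(Aᶜ) → Fin 2) :
    marginal Aᶜ σ z w = ∑ a, σ (glue A a z) (glue A a w) := by
  let e : A ≃ ↥(Aᶜᶜ) := Equiv.subtypeEquivRight fun i => by rw [compl_compl]
  have hglue : ∀ (a : A → Fin 2) (u : ↥(Aᶜ) → Fin 2), glue Aᶜ u (a ∘ e.symm) = glue A a u := by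
    intro a u
    funext i
    by_cases h : i ∈ A
    · simp only [glue, Finset.mem_compl, h, not_true_eq_false, dif_neg, not_false_eq_true, dif_pos]
      rfl
    · simp [glue, h]
  rw [marginal_apply, ← (e.arrowCongr (Equiv.refl (Fin 2))).sum_comp]
  refine Finset.sum_congr rfl fun a _ => ?_
  rw [← hglue a z, ← hglue a w]
  rfl

lemma trace_marginal (A : Finset Λ) (σ : QubitOp Λ) : (marginal A σ).trace = σ.trace := by
  rw [Matrix.trace, Matrix.trace, sum_glue A]
  rfl

lemma posSemidef_marginal (hσ : σ.PosSemidef) (A : Finset Λ) : (marginal A σ).PosSemidef := by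
  have hsum : marginal A σ = ∑ z : ↥(Aᶜ) → Fin 2,
      σ.submatrix (fun x => glue A x z) (fun x => glue A x z) := by
    ext x y
    rw [Matrix.sum_apply]
    rfl
  rw [hsum]
  exact Matrix.posSemidef_sum _ fun z _ => hσ.submatrix _

lemma IsQuantumState.marginal (hσ : IsQuantumState σ) (A : Finset Λ) :
    IsQuantumState (marginal A σ) :=
  ⟨posSemidef_marginal hσ.1 A, (trace_marginal A σ).trans hσ.2⟩

lemma marginal_regionTensor (A : Finset Λ) (X : QubitOp A) (Y : QubitOp ↥(Aᶜ)) :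
    marginal A (regionTensor A X Y) = Y.trace • X := by
  ext a b
  simp only [marginal_apply, regionTensor_glue, Matrix.smul_apply, smul_eq_mul, Matrix.trace,
    Matrix.diag_apply, Finset.sum_mul, mul_comm (X a b)]

lemma marginal_compl_regionTensor (A : Finset Λ) (X : QubitOp A) (Y : QubitOp ↥(Aᶜ)) :
    marginal Aᶜ (regionTensor A X Y) = X.trace • Y := by
  ext z w
  simp only [marginal_compl_apply, regionTensor_glue, Matrix.smul_apply, smul_eq_mul,
    Matrix.trace, Matrix.diag_apply, Finset.sum_mul]

lemma trace_regionTensor (A : Finset Λ) (X : QubitOp A) (Y : QubitOp ↥(Aᶜ)) :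
    (regionTensor A X Y).trace = X.trace * Y.trace := by
  rw [← trace_marginal A, marginal_regionTensor, Matrix.trace_smul, smul_eq_mul, mul_comm]

lemma IsQuantumState.regionTensor {X : QubitOp A} {Y : QubitOp ↥(Aᶜ)} (hX : IsQuantumState X)
    (hY : IsQuantumState Y) : IsQuantumState (regionTensor A X Y) := by
  refine ⟨?_, by rw [trace_regionTensor, hX.2, hY.2, one_mul]⟩
  rw [regionTensor_eq_submatrix]
  exact (hX.1.kronecker hY.1).submatrix _

lemma vonNeumannEntropy_regionTensor {X : QubitOp A} {Y : QubitOp ↥(Aᶜ)}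
    (hX : IsQuantumState X) (hY : IsQuantumState Y) :
    vonNeumannEntropy (regionTensor A X Y) = vonNeumannEntropy X + vonNeumannEntropy Y := by
  have hXY : (X ⊗ₖ Y).IsHermitian := (hX.1.kronecker hY.1).isHermitian
  have htrace := trace_cfc_submatrix_equiv hXY (splitEquiv A) Real.negMulLog
  rw [← regionTensor_eq_submatrix, trace_cfc (hX.regionTensor hY).1.isHermitian,
    trace_cfc_kronecker hX.1.isHermitian hY.1.isHermitian, Complex.ofReal_inj] at htrace
  simp only [Real.negMulLog_mul, Finset.sum_add_distrib, ← Finset.sum_mul, ← Finset.mul_sum,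
    hX.sum_eigenvalues, hY.sum_eigenvalues, one_mul] at htrace
  rw [vonNeumannEntropy_eq_sum (hX.regionTensor hY).1.isHermitian, htrace,
    vonNeumannEntropy_eq_sum hX.1.isHermitian, vonNeumannEntropy_eq_sum hY.1.isHermitian]

lemma mutualInformation_eq (hσ : IsQuantumState σ) (A : Finset Λ) :
    mutualInformation A σ =
      vonNeumannEntropy (regionTensor A (marginal A σ) (marginal Aᶜ σ)) - vonNeumannEntropy σ := by
  rw [mutualInformation, vonNeumannEntropy_regionTensor (hσ.marginal A) (hσ.marginal Aᶜ)]

lemma ActsTriviallyAt.apply_update {i : Λ} (h : ActsTriviallyAt O i) {x y : Λ → Fin 2}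
    (hxy : x i = y i) (b : Fin 2) :
    O (Function.update x i b) (Function.update y i b) = O x y := by
  obtain ⟨O', rfl⟩ := h
  have hne : ∀ j : ↥(({i} : Finset Λ)ᶜ), (j : Λ) ≠ i := fun j => by
    simpa using Finset.mem_compl.mp j.2
  have heq : ∀ j : ↥({i} : Finset Λ), (j : Λ) = i := fun j => Finset.mem_singleton.mp j.2
  simp [regionTensor, Matrix.submatrix_apply, Matrix.kroneckerMap_apply, hne, heq, hxy]

lemma ActsTriviallyAt.apply_eq_zero {i : Λ} (h : ActsTriviallyAt O i) {x y : Λ → Fin 2}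
    (hxy : x i ≠ y i) : O x y = 0 := by
  obtain ⟨O', rfl⟩ := h
  rw [regionTensor, Matrix.submatrix_apply, Matrix.kroneckerMap_apply, Matrix.one_apply_ne,
    zero_mul]
  exact fun he => hxy (congrFun he ⟨i, Finset.mem_singleton_self i⟩)

lemma apply_piecewise_of_actsTriviallyAt {B : Finset Λ} (hO : ∀ i ∈ B, ActsTriviallyAt O i)
    {x y : Λ → Fin 2} (hxy : ∀ i ∈ B, x i = y i) (u : Λ → Fin 2) :
    O (B.piecewise u x) (B.piecewise u y) = O x y := by
  induction B using Finset.induction_on with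
  | empty => simp only [Finset.piecewise_empty]
  | insert i B hi ih =>
    rw [Finset.piecewise_insert, Finset.piecewise_insert,
      (hO i (Finset.mem_insert_self i B)).apply_update (by
        rw [B.piecewise_eq_of_notMem _ _ hi, B.piecewise_eq_of_notMem _ _ hi,
          hxy i (Finset.mem_insert_self i B)]),
      ih (fun j hj => hO j (Finset.mem_insert_of_mem hj))
        fun j hj => hxy j (Finset.mem_insert_of_mem hj)]

lemma piecewise_glue (A : Finset Λ) (a b : A → Fin 2) (z w : ↥(Aᶜ) → Fin 2) :
    A.piecewise (glue A a z) (glue A b w) = glue A a w := by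
  funext i
  by_cases hi : i ∈ A <;> simp [glue, hi]

lemma exists_eq_regionTensor_one (hO : ∀ i ∈ A, ActsTriviallyAt O i) :
    ∃ Y : QubitOp ↥(Aᶜ), O = regionTensor A 1 Y := by
  refine ⟨Matrix.of fun z w => O (glue A 0 z) (glue A 0 w), Matrix.ext fun x y => ?_⟩
  obtain ⟨⟨a, z⟩, rfl⟩ := (splitEquiv A).symm.surjective x
  obtain ⟨⟨b, w⟩, rfl⟩ := (splitEquiv A).symm.surjective y
  change O (glue A a z) (glue A b w) = regionTensor A 1 _ (glue A a z) (glue A b w)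
  rw [regionTensor_glue, Matrix.of_apply]
  by_cases hab : a = b
  · subst hab
    rw [Matrix.one_apply_eq, one_mul, ← piecewise_glue A a 0 z z, ← piecewise_glue A a 0 z w]
    exact apply_piecewise_of_actsTriviallyAt hO (fun i hi => by simp [glue, hi]) _
  · obtain ⟨i, hi⟩ := Function.ne_iff.mp hab
    rw [Matrix.one_apply_ne hab, zero_mul]
    exact (hO i i.2).apply_eq_zero (by simpa [glue] using hi)

lemma trace_mul_regionTensor_one (σ : QubitOp Λ) (Y : QubitOp ↥(Aᶜ)) :
    (σ * regionTensor A 1 Y).trace = (marginal Aᶜ σ * Y).trace := by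
  simp only [Matrix.trace, Matrix.diag_apply, Matrix.mul_apply, sum_glue A, regionTensor_glue,
    Matrix.one_apply, ite_mul, mul_ite, one_mul, zero_mul, mul_zero, marginal_compl_apply,
    Finset.sum_mul]
  rw [Finset.sum_comm]
  refine Finset.sum_congr rfl fun z _ => .trans (Finset.sum_congr rfl fun a _ => ?_)
    Finset.sum_comm
  rw [Finset.sum_comm]
  simp only [Finset.sum_ite_eq', Finset.mem_univ, if_true]

lemma trace_mul_eq_of_actsTriviallyAt (hO : ∀ i ∈ A, ActsTriviallyAt O i)
    (h : marginal Aᶜ σ = marginal Aᶜ τ) : (σ * O).trace = (τ * O).trace := by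
  obtain ⟨Y, rfl⟩ := exists_eq_regionTensor_one hO
  rw [trace_mul_regionTensor_one, trace_mul_regionTensor_one, h]

lemma trace_mul_eq_of_not_crossesCut (hO : ¬ CrossesCut A O) (hA : marginal A σ = marginal A τ)
    (hAc : marginal Aᶜ σ = marginal Aᶜ τ) : (σ * O).trace = (τ * O).trace := by
  rcases not_and_or.mp hO with hO | hO
  · exact trace_mul_eq_of_actsTriviallyAt (fun i hi => by_contra fun hi' => hO ⟨i, hi, hi'⟩) hAc
  · exact trace_mul_eq_of_actsTriviallyAt (fun i hi => by_contra fun hi' => hO ⟨i, hi, hi'⟩)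
      (by rwa [compl_compl])

lemma trace_mul_sum_sub_trace_mul_sum {Γ : Type*} [Fintype Γ] (h : Γ → QubitOp Λ)
    (hA : marginal A σ = marginal A τ) (hAc : marginal Aᶜ σ = marginal Aᶜ τ) :
    (σ * ∑ γ, h γ).trace - (τ * ∑ γ, h γ).trace =
      (σ * boundaryHamiltonian A h).trace - (τ * boundaryHamiltonian A h).trace := by
  classical
  have hsplit : ∑ γ, h γ = boundaryHamiltonian A h + ∑ γ with ¬ CrossesCut A (h γ), h γ := by
    rw [boundaryHamiltonian]
    convert (Finset.sum_filter_add_sum_filter_not Finset.univ (fun γ => CrossesCut A (h γ)) h).symm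
  have hrest : (σ * ∑ γ with ¬ CrossesCut A (h γ), h γ).trace =
      (τ * ∑ γ with ¬ CrossesCut A (h γ), h γ).trace := by
    simp only [Finset.mul_sum, Matrix.trace_sum]
    exact Finset.sum_congr rfl fun γ hγ =>
      trace_mul_eq_of_not_crossesCut (Finset.mem_filter.mp hγ).2 hA hAc
  rw [hsplit, Matrix.mul_add, Matrix.mul_add, Matrix.trace_add, Matrix.trace_add, hrest]
  ring

/-- Only the boundary terms see the correlations that `σ_A ⊗ σ_Aᶜ` lacks. -/
lemma re_trace_regionTensor_marginal_mul_sum_sub_le {Γ : Type*} [Fintype Γ] (h : Γ → QubitOp Λ)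
    (hσ : IsQuantumState σ) (A : Finset Λ) :
    (regionTensor A (marginal A σ) (marginal Aᶜ σ) * ∑ γ, h γ).trace.re -
      (σ * ∑ γ, h γ).trace.re ≤ 2 * ‖boundaryHamiltonian A h‖ := by
  have hτ := (hσ.marginal A).regionTensor (hσ.marginal Aᶜ)
  have hsub := congrArg Complex.re (trace_mul_sum_sub_trace_mul_sum h
    (by rw [marginal_regionTensor, (hσ.marginal Aᶜ).2, one_smul])
    (by rw [marginal_compl_regionTensor, (hσ.marginal A).2, one_smul]) :
    (regionTensor A (marginal A σ) (marginal Aᶜ σ) * _).trace - (σ * _).trace = _)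
  rw [Complex.sub_re, Complex.sub_re] at hsub
  linarith [(abs_le.mp (hτ.abs_re_trace_mul_le (boundaryHamiltonian A h))).2,
    (abs_le.mp (hσ.abs_re_trace_mul_le (boundaryHamiltonian A h))).1]

end Regions

section GibbsStates

variable {Λ : Type*} [Fintype Λ] [DecidableEq Λ] {H : QubitOp Λ}

/-- The partition function `Z = Tr e^{-βH}`. -/
noncomputable def partitionFunction (hH : H.IsHermitian) (β : ℝ) : ℝ :=
  ∑ i, Real.exp (-β * hH.eigenvalues i)

lemma partitionFunction_pos (hH : H.IsHermitian) (β : ℝ) : 0 < partitionFunction hH β :=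
  Finset.sum_pos (fun _ _ => Real.exp_pos _) Finset.univ_nonempty

lemma gibbsState_eq_cfc (hH : H.IsHermitian) (β : ℝ) :
    gibbsState β H = cfc (fun x => (partitionFunction hH β)⁻¹ * Real.exp (-β * x)) H := by
  have hexp : NormedSpace.exp (-(β : ℂ) • H) = cfc (fun x => Real.exp (-β * x)) H := by
    rw [cfc_comp_const_mul (-β) Real.exp H (by fun_prop) hH.isSelfAdjoint,
      CFC.real_exp_eq_normedSpace_exp ((IsSelfAdjoint.all (-β)).smul hH.isSelfAdjoint),
      ← Complex.ofReal_neg]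
    rfl
  rw [gibbsState, hexp, trace_cfc hH, cfc_const_mul _ _ H (by fun_prop), ← Complex.ofReal_inv]
  rfl

lemma posDef_gibbsState (hH : H.IsHermitian) (β : ℝ) : (gibbsState β H).PosDef := by
  rw [gibbsState_eq_cfc hH]
  exact posDef_cfc hH fun i =>
    mul_pos (inv_pos.mpr (partitionFunction_pos hH β)) (Real.exp_pos _)

lemma log_gibbsState (hH : H.IsHermitian) (β : ℝ) :
    CFC.log (gibbsState β H) =
      algebraMap ℝ _ (-Real.log (partitionFunction hH β)) + (-β) • H := by
  rw [gibbsState_eq_cfc hH, log_cfc hH]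
  simp only [Real.log_mul (inv_ne_zero (partitionFunction_pos hH β).ne') (Real.exp_pos _).ne',
    Real.log_inv, Real.log_exp]
  rw [cfc_const_add _ _ H (by fun_prop) hH.isSelfAdjoint, cfc_const_mul_id _ H hH.isSelfAdjoint]

lemma IsQuantumState.relEntropy_gibbsState {τ : QubitOp Λ} (hτ : IsQuantumState τ)
    (hH : H.IsHermitian) (β : ℝ) :
    relEntropy τ (gibbsState β H) =
      β * (τ * H).trace.re - vonNeumannEntropy τ + Real.log (partitionFunction hH β) := by
  rw [relEntropy_eq_neg_vonNeumannEntropy_sub, log_gibbsState hH, Algebra.algebraMap_eq_smul_one,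
    Matrix.mul_add, Matrix.mul_smul, Matrix.mul_smul, Matrix.mul_one, Matrix.trace_add,
    Matrix.trace_smul, Matrix.trace_smul, hτ.2, Complex.add_re, Complex.smul_re, Complex.smul_re,
    Complex.one_re]
  simp only [smul_eq_mul]
  ring

lemma IsTwoPositive.isQuantumState_map {R : QubitOp Λ →ₗ[ℂ] QubitOp Λ} (hR : IsTwoPositive R)
    (hR_trace : ∀ X, (R X).trace = X.trace) {τ : QubitOp Λ} (hτ : IsQuantumState τ) :
    IsQuantumState (R τ) :=
  ⟨hR.posSemidef_map hτ.1, (hR_trace τ).trans hτ.2⟩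

/-- The free energy `Tr[τH] - β⁻¹ S(τ)` does not increase, because up to a constant it is the
relative entropy to the fixed point. -/
theorem vonNeumannEntropy_sub_map_le (hH : H.IsHermitian) (β : ℝ)
    {R : QubitOp Λ →ₗ[ℂ] QubitOp Λ} (hR : IsTwoPositive R)
    (hR_trace : ∀ X, (R X).trace = X.trace) (hR_fix : R (gibbsState β H) = gibbsState β H)
    {τ : QubitOp Λ} (hτ : IsQuantumState τ) :
    vonNeumannEntropy τ - vonNeumannEntropy (R τ) ≤
      β * ((τ * H).trace.re - (R τ * H).trace.re) := by
  have h := relEntropy_map_le hR hR_trace hτ.1 (posDef_gibbsState hH β)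
    (hR_fix.symm ▸ posDef_gibbsState hH β)
  rw [hR_fix, hτ.relEntropy_gibbsState hH,
    (hR.isQuantumState_map hR_trace hτ).relEntropy_gibbsState hH] at h
  linarith

end GibbsStates

theorem mainTheorem4_general {Λ Γ : Type*} [Fintype Λ] [DecidableEq Λ] [Fintype Γ]
    (h : Γ → QubitOp Λ) (h_herm : (∑ γ, h γ).IsHermitian) (β : ℝ) (hβ : 0 ≤ β) (A : Finset Λ)
    (σ : QubitOp Λ) (hσ : IsQuantumState σ) (R : QubitOp Λ →ₗ[ℂ] QubitOp Λ)
    (hR : IsTwoPositive R) (hR_trace : ∀ X, (R X).trace = X.trace)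
    (hR_fix : R (gibbsState β (∑ γ, h γ)) = gibbsState β (∑ γ, h γ)) (εMarkov : ℝ)
    (hrec : traceNorm (R (regionTensor A (marginal A σ) (marginal Aᶜ σ)) - σ) ≤ εMarkov) :
    mutualInformation A σ ≤
      2 * β * ‖boundaryHamiltonian A h‖ + 4 * εMarkov *
        max (Real.log (1 / εMarkov)) (max (β * ‖∑ γ, h γ‖) (Fintype.card Λ : ℝ)) := by
  have hτ := (hσ.marginal A).regionTensor (hσ.marginal Aᶜ)
  have hRτ := hR.isQuantumState_map hR_trace hτ
  have hfree_energy := vonNeumannEntropy_sub_map_le h_herm β hR hR_trace hR_fix hτ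
  have hboundary := mul_le_mul_of_nonneg_left
    (re_trace_regionTensor_marginal_mul_sum_sub_le h hσ A) hβ
  have henergy := mul_le_mul_of_nonneg_left
    (neg_le_of_abs_le ((abs_re_trace_mul_le (hRτ.1.isHermitian.sub hσ.1.isHermitian) _).trans
      (mul_le_mul_of_nonneg_right hrec (norm_nonneg (∑ γ, h γ))))) hβ
  have hentropy := mul_add_vonNeumannEntropy_sub_le hRτ hσ hrec (β * ‖∑ γ, h γ‖)
  rw [mutualInformation_eq hσ]
  rw [Matrix.sub_mul, Matrix.trace_sub, Complex.sub_re] at henergy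
  linarith

theorem mainTheorem4 {n : ℕ} {Γ : Type*} [Fintype Γ]
    (h : Γ → QubitOp (Fin n)) (h_herm : ∀ γ, (h γ).IsHermitian)
    (β : ℝ) (hβ : 0 ≤ β)
    (A : Finset (Fin n))
    (σ : QubitOp (Fin n)) (hσ : IsQuantumState σ)
    (R : QubitOp (Fin n) →CP QubitOp (Fin n)) (hR : IsTracePreserving R)
    (hRfix : R (gibbsState β (∑ γ, h γ)) = gibbsState β (∑ γ, h γ))
    (εMarkov : ℝ)
    (hrec : traceNorm (R (regionTensor A (marginal A σ) (marginal Aᶜ σ)) - σ) ≤ εMarkov) :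
    mutualInformation A σ ≤
      2 * β * ‖boundaryHamiltonian A h‖ +
        4 * εMarkov * max (Real.log (1 / εMarkov)) (max (β * ‖∑ γ, h γ‖) (n : ℝ)) := by
  simpa only [Fintype.card_fin] using mainTheorem4_general h
    (isSelfAdjoint_sum _ fun γ _ => h_herm γ) β hβ A σ hσ _ (isTwoPositive_of_completelyPositive R)
    hR hRfix εMarkov hrec
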